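/- Let $X$ be a metric space. For a family $\mathcal U$ of subsets of $X$ and $x\in X$ put $L_{\mathcal U}(x)=\sup_{U\in\mathcal U}\operatorname{dist}(x,X\setminus U)\in[0,\infty]$, where $\operatorname{dist}(x,\emptyset)=\infty$ and $\sup\emptyset=0$. The family $\mathcal U$ is called *coarse* if $L_{\mathcal U}(x_n)\to\infty$ for every sequence $(x_n)$ in $X$ with $x_n\to\infty$, i.e. with $d(x_n,x_0)\to\infty$ for every $x_0\in X$. A *coarse refinement* of a coarse family $\mathcal U$ is a coarse family $\mathcal V$ each of whose elements is contained in an element of $\mathcal U$. The *multiplicity* of $\mathcal V$ is the supremum over $x\in X$ of the number of elements of $\mathcal V$ containing $x$ (an element of $\{0,1,2,\dots\}\cup\{\infty\}$; it is $0$ if $X=\emptyset$). The *major coarse dimension* $\dim^{COA}_{RSE}(X)\in\{-1,0,1,\dots\}\cup\{\infty\}$ is the smallest integer $n$ such that every coarse family in $X$ has a coarse refinement of multiplicity at most $n+1$, and it is $\infty$ if there is no such $n$. **Theorem.** Let $A,B\subseteq X$ be subsets, equipped with the restricted metric, such that $X=A\cup B$. Then $$\dim^{COA}_{RSE}(X)=\max\bigl(\dim^{COA}_{RSE}(A),\dim^{COA}_{RSE}(B)\bigr).$$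 -/

import Mathlib

open Set Filter Topology

namespace CoarseDimension

noncomputable section

universe u

/-- The local Lebesgue number `L_𝒰(x) = sup {dist(x, X \ U) | U ∈ 𝒰} ∈ [0,∞]` of a family `𝒰` of
subsets of `X`; `infEDist` to the empty set is `∞`, so that `L_𝒰(x) = ∞` when `X ∈ 𝒰`, and the
supremum over the empty family is `0`. -/
def localLebesgueNumber {X : Type u} [MetricSpace X] (𝒰 : Set (Set X)) (x : X) : ENNReal :=
  ⨆ U ∈ 𝒰, Metric.infEDist x Uᶜ

/-- A function `f : X → [0,∞]` is coarsely proper if `f(xₙ) → ∞` whenever `xₙ → ∞` in `X`, that is,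
whenever the distance from `xₙ` to some (equivalently, every) base point tends to infinity. -/
def CoarselyProper {X : Type u} [MetricSpace X] (f : X → ENNReal) : Prop :=
  ∀ x : ℕ → X, (∀ x₀ : X, Tendsto (fun n => dist (x n) x₀) atTop atTop) →
    Tendsto (fun n => f (x n)) atTop (𝓝 ⊤)

/-- A family of subsets of `X` is coarse if its local Lebesgue number is coarsely proper. -/
def IsCoarse {X : Type u} [MetricSpace X] (𝒰 : Set (Set X)) : Prop :=
  CoarselyProper (localLebesgueNumber 𝒰)

/-- The global multiplicity of `𝒱`: the supremum over `x ∈ X` of the number of elements of `𝒱`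
containing `x`. -/
def familyMultiplicity {X : Type u} (𝒱 : Set (Set X)) : ℕ∞ :=
  ⨆ x : X, {V ∈ 𝒱 | x ∈ V}.encard

/-- `𝒱` is a coarse refinement of `𝒰`: it is coarse, and every element of `𝒱` is contained in an
element of `𝒰`. -/
def IsCoarseRefinement {X : Type u} [MetricSpace X] (𝒱 𝒰 : Set (Set X)) : Prop :=
  IsCoarse 𝒱 ∧ ∀ V ∈ 𝒱, ∃ U ∈ 𝒰, V ⊆ U

/-- Every coarse family in `X` has a coarse refinement of multiplicity at most `n + 1`. -/
def MajorCoarseDimLE (X : Type u) [MetricSpace X] (n : ℤ) : Prop :=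
  ∀ 𝒰 : Set (Set X), IsCoarse 𝒰 →
    ∃ 𝒱 : Set (Set X), IsCoarseRefinement 𝒱 𝒰 ∧ (familyMultiplicity 𝒱 : EReal) ≤ (((n : ℝ) + 1 : ℝ) : EReal)

/-- The major coarse dimension of `X`: the smallest integer `n` such that every coarse family in
`X` has a coarse refinement of multiplicity at most `n + 1`, and `∞` if there is none. Since a
multiplicity is never negative, only integers `n ≥ -1` occur. -/
def majorCoarseDim (X : Type u) [MetricSpace X] : EReal :=
  sInf {d : EReal | ∃ n : ℤ, MajorCoarseDimLE X n ∧ d = ((n : ℝ) : EReal)}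

end

end CoarseDimension

namespace CoarseDimension

open scoped NNReal ENNReal

/-! Monotonicity: a coarse family on `A` extends to `X` by adjoining `X \ A` to each member, and the
traces on `A` of a refinement of the extension refine the original (`MajorCoarseDimLE.subset`).
Union: `exists_shrinking` shrinks each `U` in place so that the family stays coarse on all of `X`
and has small multiplicity at points of `A`. Shrinking again for `B` only removes points, so the
bound on `A` survives and the multiplicities do not add. -/

/-- Coarse properness, tested against the distance to a fixed point of an ambient space. -/
theorem coarselyProper_iff_of_isometry {X Y : Type*} [MetricSpace X] [MetricSpace Y] {i : Y → X}
    (hi : Isometry i) (x₀ : X) (f : Y → ℝ≥0∞) :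
    CoarselyProper f ↔ ∀ M : ℝ≥0, ∃ R : ℝ, ∀ y, R ≤ dist (i y) x₀ → (M : ℝ≥0∞) ≤ f y := by
  constructor
  · intro hf M
    by_contra! h
    choose y hy hfy using fun n : ℕ => h n
    have hlim : Tendsto (fun n => f (y n)) atTop (𝓝 ⊤) := by
      refine hf y fun y₀ => tendsto_atTop_mono (f := fun n : ℕ => (n : ℝ) - dist (i y₀) x₀) ?_ ?_
      · intro n
        have h1 := dist_triangle (i (y n)) (i y₀) x₀
        rw [hi.dist_eq] at h1
        linarith [hy n]
      · exact tendsto_atTop_add_const_right _ _ tendsto_natCast_atTop_atTop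
    obtain ⟨n, hn⟩ := (ENNReal.tendsto_nhds_top_iff_nnreal.1 hlim M).exists
    exact (hn.trans (hfy n)).false
  · intro h y hy
    rw [ENNReal.tendsto_nhds_top_iff_nnreal]
    intro M
    obtain ⟨R, hR⟩ := h (M + 1)
    filter_upwards [(hy (y 0)).eventually_ge_atTop (R + dist (i (y 0)) x₀)] with n hn
    refine lt_of_lt_of_le ?_ (hR (y n) ?_)
    · exact_mod_cast lt_add_one M
    · have h1 := dist_triangle_right (i (y n)) (i (y 0)) x₀
      rw [hi.dist_eq] at h1
      linarith

theorem coarselyProper_iff {X : Type*} [MetricSpace X] (x₀ : X) (f : X → ℝ≥0∞) :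
    CoarselyProper f ↔ ∀ M : ℝ≥0, ∃ R : ℝ, ∀ x, R ≤ dist x x₀ → (M : ℝ≥0∞) ≤ f x :=
  coarselyProper_iff_of_isometry isometry_id x₀ f

theorem coarselyProper_subtype_iff {X : Type*} [MetricSpace X] {A : Set X} (x₀ : X)
    (f : A → ℝ≥0∞) :
    CoarselyProper f ↔ ∀ M : ℝ≥0, ∃ R : ℝ, ∀ a : A, R ≤ dist (a : X) x₀ → (M : ℝ≥0∞) ≤ f a :=
  coarselyProper_iff_of_isometry isometry_subtype_coe x₀ f

theorem coarselyProper_of_isEmpty {X : Type*} [MetricSpace X] [IsEmpty X] (f : X → ℝ≥0∞) :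
    CoarselyProper f :=
  fun x => isEmptyElim (x 0)

theorem infEDist_le_localLebesgueNumber {X : Type*} [MetricSpace X] {𝒰 : Set (Set X)} {U : Set X}
    (hU : U ∈ 𝒰) (x : X) : Metric.infEDist x Uᶜ ≤ localLebesgueNumber 𝒰 x :=
  le_iSup₂ (f := fun U (_ : U ∈ 𝒰) => Metric.infEDist x Uᶜ) U hU

theorem exists_lt_infEDist {X : Type*} [MetricSpace X] {𝒰 : Set (Set X)} {x : X} {M : ℝ≥0∞}
    (h : M < localLebesgueNumber 𝒰 x) : ∃ U ∈ 𝒰, M < Metric.infEDist x Uᶜ := by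
  simpa [localLebesgueNumber, lt_iSup_iff] using h

theorem localLebesgueNumber_le_add_edist {X : Type*} [MetricSpace X] (𝒰 : Set (Set X)) (x y : X) :
    localLebesgueNumber 𝒰 x ≤ localLebesgueNumber 𝒰 y + edist x y :=
  iSup₂_le fun _ hU => Metric.infEDist_le_infEDist_add_edist.trans
    (add_le_add_left (infEDist_le_localLebesgueNumber hU y) _)

theorem mem_of_lt_infEDist_compl {X : Type*} [MetricSpace X] {U : Set X} {x : X} {M : ℝ≥0∞}
    (h : M < Metric.infEDist x Uᶜ) : x ∈ U := by
  by_contra hx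
  rw [Metric.infEDist_zero_of_mem (s := Uᶜ) hx] at h
  exact not_lt_zero h

theorem encard_le_familyMultiplicity {X : Type*} (𝒱 : Set (Set X)) (x : X) :
    {V ∈ 𝒱 | x ∈ V}.encard ≤ familyMultiplicity 𝒱 :=
  le_iSup (fun x : X => {V ∈ 𝒱 | x ∈ V}.encard) x

theorem coe_ereal_mono {a b : ℕ∞} (h : a ≤ b) : (a : EReal) ≤ (b : EReal) :=
  EReal.coe_ennreal_le_coe_ennreal_iff.2 (ENat.toENNReal_le.2 h)

theorem MajorCoarseDimLE.mono {X : Type*} [MetricSpace X] {m n : ℤ} (h : MajorCoarseDimLE X m)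
    (hmn : m ≤ n) : MajorCoarseDimLE X n := by
  intro 𝒰 h𝒰
  obtain ⟨𝒱, h𝒱, hm⟩ := h 𝒰 h𝒰
  have : (m : ℝ) + 1 ≤ (n : ℝ) + 1 := by exact_mod_cast Int.add_le_add_right hmn 1
  exact ⟨𝒱, h𝒱, hm.trans (EReal.coe_le_coe_iff.2 this)⟩

theorem majorCoarseDim_le {X : Type*} [MetricSpace X] {n : ℤ} (h : MajorCoarseDimLE X n) :
    majorCoarseDim X ≤ ((n : ℝ) : EReal) :=
  sInf_le ⟨n, h, rfl⟩

/-- The family `{U ∪ (X \ A) | U ∈ 𝒰}` extends a family of subsets of `A` to `X`. -/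
def extendFamily {X : Type*} {A : Set X} (𝒰 : Set (Set A)) : Set (Set X) :=
  (fun U : Set A => (((↑) : A → X) '' Uᶜ)ᶜ) '' 𝒰

/-- The depth of `x` in an extended member is its distance to `A \ U`. Far from `A` any member
serves, which needs `𝒰` nonempty; near `A` the depth is compared with that at a nearby point of `A`.
-/
theorem IsCoarse.extendFamily {X : Type*} [MetricSpace X] {A : Set X} {𝒰 : Set (Set A)}
    (h𝒰 : IsCoarse 𝒰) (hne : 𝒰.Nonempty) : IsCoarse (extendFamily 𝒰) := by
  cases isEmpty_or_nonempty X with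
  | inl h => exact coarselyProper_of_isEmpty _
  | inr h =>
  obtain ⟨x₀⟩ := h
  refine (coarselyProper_iff x₀ _).2 fun M => ?_
  obtain ⟨R, hR⟩ := (coarselyProper_subtype_iff x₀ _).1 h𝒰 (M + M + 1)
  refine ⟨R + M, fun x hx => ?_⟩
  have key : ∀ U ∈ 𝒰, (M : ℝ≥0∞) ≤ Metric.infEDist x (((↑) : A → X) '' Uᶜ) →
      (M : ℝ≥0∞) ≤ localLebesgueNumber (CoarseDimension.extendFamily 𝒰) x := by
    intro U hU h
    refine h.trans ?_
    have := infEDist_le_localLebesgueNumber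
      (mem_image_of_mem (fun U : Set A => (((↑) : A → X) '' Uᶜ)ᶜ) hU) x
    rwa [compl_compl] at this
  by_cases hA : (M : ℝ≥0∞) ≤ Metric.infEDist x A
  · obtain ⟨U, hU⟩ := hne
    exact key U hU (hA.trans (Metric.infEDist_anti (by simp)))
  · obtain ⟨a, ha, hxa⟩ := Metric.infEDist_lt_iff.1 (not_le.1 hA)
    have hxa' : dist x a < M := by
      rwa [edist_nndist, ENNReal.coe_lt_coe, ← NNReal.coe_lt_coe, coe_nndist] at hxa
    have hL := hR ⟨a, ha⟩ (by have := dist_triangle x a x₀; linarith)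
    obtain ⟨U, hU, hlt⟩ := exists_lt_infEDist (M := (M : ℝ≥0∞) + M) (lt_of_lt_of_le
      (by exact_mod_cast lt_add_one (M + M)) hL)
    refine key U hU (Metric.le_infEDist.2 ?_)
    rintro _ ⟨b, hb, rfl⟩
    have h1 : (M : ℝ≥0∞) + M < edist a (b : X) :=
      hlt.trans_le (Metric.infEDist_le_edist_of_mem hb)
    have h2 : (M : ℝ≥0∞) + M < M + edist x (b : X) := by
      refine h1.trans_le ((edist_triangle_left a (b : X) x).trans ?_)
      gcongr
    exact (ENNReal.add_lt_add_iff_left ENNReal.coe_ne_top).1 h2 |>.le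

theorem MajorCoarseDimLE.subset {X : Type*} [MetricSpace X] {n : ℤ} (h : MajorCoarseDimLE X n)
    (A : Set X) : MajorCoarseDimLE A n := by
  intro 𝒰 h𝒰
  obtain rfl | hne := 𝒰.eq_empty_or_nonempty
  -- The empty family may be coarse on a bounded `A` while its extension is not coarse on `X`. Any
  -- coarse family on `X` yields `0 ≤ n + 1`, which is all that is needed.
  · obtain ⟨𝒱, -, hm⟩ := h {univ} (by
      intro x _
      have : ∀ x : X, localLebesgueNumber {univ} x = ⊤ := by simp [localLebesgueNumber]
      simp [this])
    refine ⟨∅, ⟨h𝒰, by simp⟩, (coe_ereal_mono ?_).trans hm⟩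
    simp [familyMultiplicity]
  obtain ⟨𝒱, ⟨hc, href⟩, hm⟩ := h _ (h𝒰.extendFamily hne)
  refine ⟨(fun V => ((↑) : A → X) ⁻¹' V) '' 𝒱, ⟨?_, ?_⟩, (coe_ereal_mono ?_).trans hm⟩
  · cases isEmpty_or_nonempty X with
    | inl h =>
      have : IsEmpty A := ⟨fun a => isEmptyElim (a : X)⟩
      exact coarselyProper_of_isEmpty _
    | inr h =>
    obtain ⟨x₀⟩ := h
    refine (coarselyProper_subtype_iff x₀ _).2 fun M => ?_
    obtain ⟨R, hR⟩ := (coarselyProper_iff x₀ _).1 hc M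
    refine ⟨R, fun a ha => (hR a ha).trans (iSup₂_le fun V hV => ?_)⟩
    refine le_trans ?_ (infEDist_le_localLebesgueNumber (mem_image_of_mem _ hV) a)
    exact Metric.le_infEDist.2 fun b hb => Metric.infEDist_le_edist_of_mem (s := Vᶜ) hb
  · rintro _ ⟨V, hV, rfl⟩
    obtain ⟨_, ⟨U, hU, rfl⟩, hVU⟩ := href V hV
    refine ⟨U, hU, fun a ha => ?_⟩
    by_contra haU
    exact hVU ha ⟨a, haU, rfl⟩
  · refine iSup_le fun a => le_trans ?_ (encard_le_familyMultiplicity 𝒱 a)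
    refine le_trans (encard_le_encard ?_)
      (encard_image_le (fun V => ((↑) : A → X) ⁻¹' V) {V ∈ 𝒱 | (a : X) ∈ V})
    rintro _ ⟨⟨V, hV, rfl⟩, ha⟩
    exact ⟨V, ⟨hV, ha⟩, rfl⟩

/-- A finite truncation of the local Lebesgue number. -/
noncomputable def truncatedLebesgueNumber {X : Type*} [MetricSpace X] (𝒰 : Set (Set X)) (x₀ x : X) : ℝ≥0∞ :=
  min (localLebesgueNumber 𝒰 x) (edist x x₀)

theorem truncatedLebesgueNumber_ne_top {X : Type*} [MetricSpace X] (𝒰 : Set (Set X)) (x₀ x : X) :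
    truncatedLebesgueNumber 𝒰 x₀ x ≠ ⊤ :=
  ne_top_of_le_ne_top (edist_ne_top x x₀) (min_le_right _ _)

theorem truncatedLebesgueNumber_le_add_edist {X : Type*} [MetricSpace X] (𝒰 : Set (Set X))
    (x₀ x y : X) :
    truncatedLebesgueNumber 𝒰 x₀ x ≤ truncatedLebesgueNumber 𝒰 x₀ y + edist x y := by
  rw [truncatedLebesgueNumber, truncatedLebesgueNumber, ← min_add_add_right]
  refine min_le_min (localLebesgueNumber_le_add_edist 𝒰 x y) ?_
  rw [add_comm]
  exact edist_triangle x y x₀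

theorem IsCoarse.exists_le_truncatedLebesgueNumber {X : Type*} [MetricSpace X] {𝒰 : Set (Set X)}
    (h𝒰 : IsCoarse 𝒰) (x₀ : X) (M : ℝ≥0) :
    ∃ R : ℝ, ∀ x, R ≤ dist x x₀ → (M : ℝ≥0∞) ≤ truncatedLebesgueNumber 𝒰 x₀ x := by
  obtain ⟨R, hR⟩ := (coarselyProper_iff x₀ _).1 h𝒰 M
  refine ⟨max R M, fun x hx => le_min (hR x ((le_max_left _ _).trans hx)) ?_⟩
  rw [edist_nndist, ENNReal.coe_le_coe, ← NNReal.coe_le_coe, coe_nndist]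
  exact (le_max_right _ _).trans hx

/-- The points lying in `U` at a depth of at least half the truncated Lebesgue number of `𝒰`. -/
def deepPart {X : Type*} [MetricSpace X] (𝒰 : Set (Set X)) (x₀ : X) (U : Set X) : Set X :=
  {x | truncatedLebesgueNumber 𝒰 x₀ x ≤ 2 * Metric.infEDist x Uᶜ}

/-- Let `r` be the truncated number at `x` and `e` the distance to `y`. Some `U` has depth over
`3r/4` at `x`; if `y` is not deep, its depth is below `(r + e)/2`. Hence `3r/4 < (r + e)/2 + e`, so
`r < 6e`. Truncation makes `r` finite, so that `3r/4 < r`. -/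
theorem exists_truncatedLebesgueNumber_le_infEDist_deepPart {X : Type*} [MetricSpace X]
    {𝒰 : Set (Set X)} {x₀ x : X} (hx : truncatedLebesgueNumber 𝒰 x₀ x ≠ 0) :
    ∃ U ∈ 𝒰, ∀ y ∉ deepPart 𝒰 x₀ U, truncatedLebesgueNumber 𝒰 x₀ x ≤ 6 * edist x y := by
  set r := truncatedLebesgueNumber 𝒰 x₀ x with hr
  have hrt : r ≠ ⊤ := truncatedLebesgueNumber_ne_top 𝒰 x₀ x
  have hr0 : 0 < r.toReal := ENNReal.toReal_pos hx hrt
  have hlt : ENNReal.ofReal (3 / 4 * r.toReal) < localLebesgueNumber 𝒰 x := by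
    refine lt_of_lt_of_le ?_ (min_le_left _ (edist x x₀))
    change _ < r
    rw [← ENNReal.ofReal_toReal hrt, ENNReal.toReal_ofReal hr0.le]
    exact (ENNReal.ofReal_lt_ofReal_iff hr0).2 (by linarith)
  obtain ⟨U, hU, hUx⟩ := exists_lt_infEDist hlt
  refine ⟨U, hU, fun y hy => ?_⟩
  have hy : 2 * Metric.infEDist y Uᶜ < truncatedLebesgueNumber 𝒰 x₀ y := not_le.1 hy
  have h1 : Metric.infEDist x Uᶜ ≤ Metric.infEDist y Uᶜ + edist x y :=
    Metric.infEDist_le_infEDist_add_edist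
  have h2 : truncatedLebesgueNumber 𝒰 x₀ y ≤ r + edist y x :=
    truncatedLebesgueNumber_le_add_edist 𝒰 x₀ y x
  have hst : truncatedLebesgueNumber 𝒰 x₀ y ≠ ⊤ := truncatedLebesgueNumber_ne_top 𝒰 x₀ y
  have hft : Metric.infEDist y Uᶜ ≠ ⊤ := by
    intro h
    rw [h] at hy
    simp at hy
  have h3 := hUx.trans_le h1
  rw [edist_comm y x] at h2
  have het := edist_ne_top x y
  generalize truncatedLebesgueNumber 𝒰 x₀ y = s at *
  generalize Metric.infEDist y Uᶜ = f at *
  generalize edist x y = e at *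
  clear_value r
  lift r to ℝ≥0 using hrt
  lift s to ℝ≥0 using hst
  lift f to ℝ≥0 using hft
  lift e to ℝ≥0 using het
  have h3' := (ENNReal.ofReal_lt_iff_lt_toReal (by positivity) (by simp)).1 h3
  norm_cast at hy h2 ⊢
  rw [← NNReal.coe_lt_coe] at hy
  rw [← NNReal.coe_le_coe] at h2 ⊢
  rw [ENNReal.toReal_add (by simp) (by simp)] at h3'
  push_cast at *
  simp only [ENNReal.coe_toReal] at *
  linarith

/-- The trace on `A` of the deep parts of the elements of a coarse family. -/
theorem IsCoarse.deepPart_preimage {X : Type*} [MetricSpace X] {𝒰 : Set (Set X)}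
    (h𝒰 : IsCoarse 𝒰) (A : Set X) (x₀ : X) :
    IsCoarse ((fun U => ((↑) : A → X) ⁻¹' deepPart 𝒰 x₀ U) '' 𝒰) := by
  refine (coarselyProper_subtype_iff x₀ _).2 fun M => ?_
  obtain ⟨R, hR⟩ := h𝒰.exists_le_truncatedLebesgueNumber x₀ (6 * M + 1)
  refine ⟨R, fun a ha => ?_⟩
  have hM := hR a ha
  have h0 : truncatedLebesgueNumber 𝒰 x₀ (a : X) ≠ 0 := by
    intro h
    rw [h] at hM
    simp at hM
  obtain ⟨U, hU, hUa⟩ := exists_truncatedLebesgueNumber_le_infEDist_deepPart h0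
  refine le_trans ?_ (infEDist_le_localLebesgueNumber (mem_image_of_mem _ hU) a)
  refine Metric.le_infEDist.2 fun b hb => ?_
  have h1 : (6 : ℝ≥0∞) * M ≤ 6 * edist (a : X) b := by
    refine le_trans ?_ (hM.trans (hUa b hb))
    push_cast
    exact le_self_add
  exact (ENNReal.mul_le_mul_iff_right (by simp) (by simp)).1 h1

/-- Replace each `U` by a subset whose trace on `A` is a union of elements of a coarse family of
small multiplicity in `A`. -/
theorem IsCoarse.exists_shrinking {X : Type*} [MetricSpace X] {𝒰 : Set (Set X)}
    (h𝒰 : IsCoarse 𝒰) {A : Set X} {n : ℤ} (hA : MajorCoarseDimLE A n) :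
    ∃ φ : Set X → Set X, (∀ U, φ U ⊆ U) ∧ IsCoarse (φ '' 𝒰) ∧ ∃ m : ℕ∞,
      (m : EReal) ≤ (((n : ℝ) + 1 : ℝ) : EReal) ∧ ∀ x ∈ A, {U ∈ 𝒰 | x ∈ φ U}.encard ≤ m := by
  cases isEmpty_or_nonempty X with
  | inl h =>
    have : IsEmpty A := ⟨fun a => isEmptyElim (a : X)⟩
    obtain ⟨𝒱, -, hm⟩ := hA ∅ (coarselyProper_of_isEmpty _)
    exact ⟨id, fun _ => subset_rfl, coarselyProper_of_isEmpty _, _, hm, fun x => isEmptyElim x⟩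
  | inr h =>
  obtain ⟨x₀⟩ := h
  obtain ⟨𝒱, ⟨hc, href⟩, hm⟩ := hA _ (h𝒰.deepPart_preimage A x₀)
  have href' : ∀ V : Set A, ∃ U : Set X, V ∈ 𝒱 → U ∈ 𝒰 ∧ ∀ a ∈ V, (a : X) ∈ deepPart 𝒰 x₀ U := by
    intro V
    by_cases hV : V ∈ 𝒱
    · obtain ⟨_, ⟨U, hU, rfl⟩, hVU⟩ := href V hV
      exact ⟨U, fun _ => ⟨hU, fun a ha => hVU ha⟩⟩
    · exact ⟨∅, fun h => absurd h hV⟩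
  choose c hcV using href'
  -- From `U`, delete only the points of `A` not covered by some `V` assigned to `U`; points off `A`
  -- stay.
  refine ⟨fun U => {x ∈ U | ∀ hx : x ∈ A, ∃ V ∈ 𝒱, c V = U ∧ ⟨x, hx⟩ ∈ V}, fun U => sep_subset _ _,
    ?_, familyMultiplicity 𝒱, hm, fun x hx => ?_⟩
  · refine (coarselyProper_iff x₀ _).2 fun M => ?_
    -- A deep point has at least half of `4M + 1`, hence depth at least `2M` in `U`; passing from `a
    -- ∈ A` to `x` within `M` of it leaves `M`.
    obtain ⟨R₁, hR₁⟩ := h𝒰.exists_le_truncatedLebesgueNumber x₀ (4 * M + 1)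
    obtain ⟨R₂, hR₂⟩ := (coarselyProper_subtype_iff x₀ _).1 hc (M + M + 1)
    refine ⟨max R₁ R₂ + M, fun x hx => ?_⟩
    have hx₁ : R₁ + M ≤ dist x x₀ := by linarith [le_max_left R₁ R₂]
    have hx₂ : R₂ + M ≤ dist x x₀ := by linarith [le_max_right R₁ R₂]
    have hM0 : (0 : ℝ) ≤ M := M.2
    by_cases hxA : (M : ℝ≥0∞) ≤ Metric.infEDist x A
    · have hL : (M : ℝ≥0∞) < localLebesgueNumber 𝒰 x := by
        refine lt_of_lt_of_le ?_ ((hR₁ x (by linarith)).trans (min_le_left _ _))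
        rw [ENNReal.coe_lt_coe, ← NNReal.coe_lt_coe]
        push_cast
        linarith
      obtain ⟨U, hU, hlt⟩ := exists_lt_infEDist hL
      refine le_trans ?_ (infEDist_le_localLebesgueNumber (mem_image_of_mem _ hU) x)
      refine Metric.le_infEDist.2 fun y hy => ?_
      by_cases hyA : y ∈ A
      · exact hxA.trans (Metric.infEDist_le_edist_of_mem hyA)
      · refine hlt.le.trans (Metric.infEDist_le_edist_of_mem fun hyU => hy ⟨hyU, fun h => ?_⟩)
        exact absurd h hyA
    · obtain ⟨a, ha, hxa⟩ := Metric.infEDist_lt_iff.1 (not_le.1 hxA)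
      have hxa' : dist x a < M := by
        rwa [edist_nndist, ENNReal.coe_lt_coe, ← NNReal.coe_lt_coe, coe_nndist] at hxa
      have htri := dist_triangle x a x₀
      obtain ⟨V, hV, hlt⟩ := exists_lt_infEDist (M := (M : ℝ≥0∞) + M) (lt_of_lt_of_le
        (by exact_mod_cast lt_add_one (M + M)) (hR₂ ⟨a, ha⟩ (by change _ ≤ dist a x₀; linarith)))
      obtain ⟨hU, hVU⟩ := hcV V hV
      have hdeep : (2 : ℝ≥0∞) * (M + M) ≤ 2 * Metric.infEDist a (c V)ᶜ := by
        refine le_trans ?_ ((hR₁ a (by linarith)).trans (hVU ⟨a, ha⟩ (mem_of_lt_infEDist_compl hlt)))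
        norm_cast
        rw [← NNReal.coe_le_coe]
        push_cast
        linarith
      have hdeep := (ENNReal.mul_le_mul_iff_right (by simp) (by simp)).1 hdeep
      refine le_trans ?_ (infEDist_le_localLebesgueNumber (mem_image_of_mem _ hU) x)
      refine Metric.le_infEDist.2 fun y hy => ?_
      -- A point outside the shrunken set is either in `A` but outside `V`, or outside `c V`;
      -- refinement by deep parts handles the latter, even off `A`.
      have h1 : (M : ℝ≥0∞) + M ≤ edist a y := by
        by_cases hyU : y ∈ c V
        · have hyA : ∃ hyA : y ∈ A, (⟨y, hyA⟩ : A) ∉ V := by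
            by_contra! h
            exact hy ⟨hyU, fun hyA => ⟨V, hV, rfl, h hyA⟩⟩
          obtain ⟨hyA, hyV⟩ := hyA
          exact hlt.le.trans (Metric.infEDist_le_edist_of_mem (s := Vᶜ) hyV)
        · exact hdeep.trans (Metric.infEDist_le_edist_of_mem (s := (c V)ᶜ) hyU)
      have h2 : (M : ℝ≥0∞) + M ≤ M + edist x y := by
        refine h1.trans ((edist_triangle_left a y x).trans ?_)
        gcongr
      exact (ENNReal.add_le_add_iff_left ENNReal.coe_ne_top).1 h2
  · refine le_trans ?_ (encard_le_familyMultiplicity 𝒱 ⟨x, hx⟩)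
    refine le_trans (encard_le_encard ?_) (encard_image_le c {V ∈ 𝒱 | (⟨x, hx⟩ : A) ∈ V})
    rintro U ⟨-, -, hxU⟩
    obtain ⟨V, hV, rfl, hxV⟩ := hxU hx
    exact ⟨V, ⟨hV, hxV⟩, rfl⟩

theorem MajorCoarseDimLE.union {X : Type*} [MetricSpace X] {A B : Set X} (hAB : A ∪ B = univ)
    {n : ℤ} (hA : MajorCoarseDimLE A n) (hB : MajorCoarseDimLE B n) : MajorCoarseDimLE X n := by
  intro 𝒰 h𝒰
  obtain ⟨φ, hφ, hφc, p, hp, hpA⟩ := h𝒰.exists_shrinking hA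
  obtain ⟨ψ, hψ, hψc, q, hq, hqB⟩ := hφc.exists_shrinking hB
  refine ⟨ψ '' (φ '' 𝒰), ⟨hψc, ?_⟩, le_trans (coe_ereal_mono (b := max p q) ?_) ?_⟩
  · rintro _ ⟨_, ⟨U, hU, rfl⟩, rfl⟩
    exact ⟨U, hU, (hψ _).trans (hφ U)⟩
  · refine iSup_le fun x => ?_
    rcases (hAB ▸ mem_univ x : x ∈ A ∪ B) with hx | hx
    -- The bound on `A` counts indices `U`, not sets `φ U`, so it passes to the images under `ψ ∘
    -- φ`.
    · refine le_trans (le_trans (encard_le_encard ?_)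
        (encard_image_le (ψ ∘ φ) {U ∈ 𝒰 | x ∈ φ U})) ((hpA x hx).trans (le_max_left _ _))
      rintro _ ⟨⟨_, ⟨U, hU, rfl⟩, rfl⟩, hxU⟩
      exact ⟨U, ⟨hU, hψ _ hxU⟩, rfl⟩
    · refine le_trans (le_trans (encard_le_encard ?_)
        (encard_image_le ψ {U ∈ φ '' 𝒰 | x ∈ ψ U})) ((hqB x hx).trans (le_max_right _ _))
      rintro _ ⟨⟨U, hU, rfl⟩, hxU⟩
      exact ⟨U, ⟨hU, hxU⟩, rfl⟩
  · rcases max_choice p q with h | h <;> rw [h] <;> assumption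

end CoarseDimension

theorem mainTheorem10 {X : Type*} [MetricSpace X] (A B : Set X) (hAB : A ∪ B = Set.univ) :
    CoarseDimension.majorCoarseDim X =
      max (CoarseDimension.majorCoarseDim A) (CoarseDimension.majorCoarseDim B) := by
  apply le_antisymm
  · refine le_of_forall_gt fun c hc => ?_
    obtain ⟨hA, hB⟩ := max_lt_iff.1 hc
    obtain ⟨_, ⟨m, hm, rfl⟩, hmc⟩ := sInf_lt_iff.1 hA
    obtain ⟨_, ⟨k, hk, rfl⟩, hkc⟩ := sInf_lt_iff.1 hB
    refine (CoarseDimension.majorCoarseDim_le (CoarseDimension.MajorCoarseDimLE.union hAB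
      (hm.mono (le_max_left m k)) (hk.mono (le_max_right m k)))).trans_lt ?_
    rcases max_choice m k with h | h <;> rw [h] <;> assumption
  · refine le_sInf ?_
    rintro _ ⟨n, hn, rfl⟩
    exact max_le (CoarseDimension.majorCoarseDim_le (hn.subset A))
      (CoarseDimension.majorCoarseDim_le (hn.subset B))
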